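/- Let $d\in\mathbb N$ and $1<p\le\infty$. Let $b:\mathbb R^d\to\mathbb R^d$ be a Borel vector field, bounded by $B$ (that is, $|b(x)|\le B$ for all $x$), belonging to $W^{1,p}(\mathbb R^d;\mathbb R^d)$ with $\|Db\|_{L^p(\mathbb R^d)}\le D$, with $[\mathrm{div}\,b]^-\in L^\infty(\mathbb R^d)$, and one-sided Lipschitz on every compact set: for every compact $S\subset\mathbb R^d$ there is $\nu_S\in\mathbb R$ with $$\langle b(x)-b(y),x-y\rangle\le\nu_S|x-y|^2\qquad\text{for all }x,y\in S.$$ Let $T>0$ and let $X:[0,T]\times\mathbb R^d\to\mathbb R^d$ be a regular Lagrangian flow of $b$ with compressibility constant $L$: for almost every $x$ the map $t\mapsto X(t,x)$ is absolutely continuous with $X(t,x)=x+\int_0^t b(X(s,x))\,ds$ for $t\in[0,T]$, and $X(t,\cdot)_\#m\le L\,m$ for every $t\in[0,T]$, where $m$ is Lebesgue measure. Let $0<R\le\rho$. There is a $\kappa>0$ that is a one-sided Lipschitz constant of $b$ on the closed ball of radius $\rho+TB$ about $0$. For every such $\kappa$, set $$K=c\,L^{1/p}\,D\,B,\qquad C_{\exp}=\exp\bigl(T(2\kappa+KT)\bigr),$$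 where $c>0$ depends only on $d$ and $p$ (and $L^{1/p}=1$ if $p=\infty$). Then there is a constant $C\ge0$, depending only on $d,p,R,\rho,T,B,\kappa,K$, such that the following holds for every time step $h>0$ and every $n\ge0$ with $t_n=nh\le T$. For every measurable $X_0$ on $B_R(0)$ with $|X_0|\le\rho$ almost everywhere, the explicit Euler iterates $X_{n+1}=X_n+h\,b(X_n)$ satisfy $X(t_n)-X_n\in L^p(B_R(0))$ and $$\|X(t_n)-X_n\|_{L^p(B_R(0))}\le C\sqrt{\frac{C_{\exp}-1}{2\kappa}}\;h^{1/2}+C_{\exp}\,\|X(0)-X_0\|_{L^p(B_R(0))}.$$ In particular, for $X_0(x)=x$, $$\|X(t_n)-X_n\|_{L^p(B_R(0))}\le C\sqrt{\frac{C_{\exp}-1}{2\kappa}}\;h^{1/2},$$ so the scheme converges with order $1/2$, uniformly over the grid times $t_n\in[0,T]$. -/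

import Mathlib

open MeasureTheory Metric Set
open scoped ENNReal NNReal ContDiff

noncomputable section

/-- The Euclidean space `ℝ^d`. -/
abbrev Rd (d : ℕ) : Type := EuclideanSpace ℝ (Fin d)

/-- `Db` is the weak (distributional) derivative of the vector field `b`:
both are locally integrable and `∫ (∂_v φ) b = - ∫ φ (Db v)` for every direction `v` and every
test function `φ ∈ C_c^∞(ℝ^d)`. -/
def HasWeakDeriv {d : ℕ} (b : Rd d → Rd d) (Db : Rd d → Rd d →L[ℝ] Rd d) : Prop :=
  LocallyIntegrable b volume ∧ LocallyIntegrable Db volume ∧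
    ∀ φ : Rd d → ℝ, ContDiff ℝ ∞ φ → HasCompactSupport φ → ∀ v : Rd d,
      ∫ x, (fderiv ℝ φ x v) • b x = - ∫ x, φ x • (Db x v)

/-- `b ∈ W^{1,p}(ℝ^d; ℝ^d)`, with weak derivative `Db`. -/
structure MemW1p {d : ℕ} (p : ℝ≥0∞) (b : Rd d → Rd d) (Db : Rd d → Rd d →L[ℝ] Rd d) : Prop where
  weakDeriv : HasWeakDeriv b Db
  memLp : MemLp b p volume
  memLp_deriv : MemLp Db p volume

/-- The negative part `[div b]^-` of the divergence of a vector field with weak derivative `Db`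
(the divergence is the trace of the weak derivative). -/
def divNegPart {d : ℕ} (Db : Rd d → Rd d →L[ℝ] Rd d) (x : Rd d) : ℝ :=
  max (-(LinearMap.trace ℝ (Rd d) (Db x : Rd d →ₗ[ℝ] Rd d))) 0

/-- The autonomous field `b` satisfies the one-sided Lipschitz condition on `S ⊆ ℝ^d`
with constant `ν`. -/
def OneSidedLipschitzOn {d : ℕ} (b : Rd d → Rd d) (S : Set (Rd d)) (ν : ℝ) : Prop :=
  ∀ x ∈ S, ∀ y ∈ S, inner ℝ (b x - b y) (x - y) ≤ ν * ‖x - y‖ ^ 2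

/-- `X : [0,T] × ℝ^d → ℝ^d` is a regular Lagrangian flow of the autonomous field `b`, with
compressibility constant `L`. An absolutely continuous integral solution `γ` of `γ' = b(γ)`,
`γ(0) = x`, is one for which `b ∘ γ` is integrable and `γ(t) = x + ∫_0^t b(γ(s)) ds`. -/
structure IsRegularLagrangianFlow {d : ℕ} (T : ℝ) (b : Rd d → Rd d) (X : ℝ → Rd d → Rd d)
    (L : ℝ≥0) : Prop where
  aemeasurable : ∀ t ∈ Icc 0 T, AEMeasurable (X t) volume
  integral_solution : ∀ᵐ x ∂(volume : Measure (Rd d)),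
    IntervalIntegrable (fun s => b (X s x)) volume 0 T ∧
      ∀ t ∈ Icc 0 T, X t x = x + ∫ s in (0 : ℝ)..t, b (X s x)
  compress : ∀ t ∈ Icc 0 T, Measure.map (X t) volume ≤ (L : ℝ≥0∞) • (volume : Measure (Rd d))

/-- The explicit Euler iterates `X_{n+1} = X_n + h b(X_n)`, as functions of the space variable,
started from `X₀`. -/
def eulerIter {d : ℕ} (b : Rd d → Rd d) (h : ℝ) (X₀ : Rd d → Rd d) : ℕ → Rd d → Rd d
  | 0 => X₀
  | n + 1 => fun x => eulerIter b h X₀ n x + h • b (eulerIter b h X₀ n x)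

/-- `C_exp = exp (T (2κ + K T))`. -/
def expConst (T κ K : ℝ) : ℝ := Real.exp (T * (2 * κ + K * T))

end

/-! The estimate is pointwise in the starting point. A trajectory from `‖x‖ ≤ ρ` and iterates from
`‖X₀ x‖ ≤ ρ` move at speed at most `B`, so up to time `T` both stay in the ball of radius `ρ + T B`,
where `b` is one-sided Lipschitz. Expanding the squared error over one step gives growth `1 + 4κh`
and a defect `O(h²)` (`norm_sq_euler_step_le`): `b` need not be continuous, so `b (γ s) - b y` is
only bounded by `2B`. Discrete Grönwall sums these defects to a squared error `O(h)`, hence order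
`1/2` after a square root. Integrating over the ball of radius `R`, which has finite measure, gives
the `L^p` bound with `exp (2κT)`. This is at most `C_exp` because `K ≥ 0`. -/

section EulerErrorPointwise

variable {E : Type*} [NormedAddCommGroup E] [InnerProductSpace ℝ E]

/-- An integral curve of a field bounded by `B` is `B`-Lipschitz. -/
lemma norm_integralCurve_sub_le {b : E → E} {B T : ℝ} {γ : ℝ → E} {x : E}
    (hB : ∀ x, ‖b x‖ ≤ B) (hint : IntervalIntegrable (fun s => b (γ s)) volume 0 T)
    (hγ : ∀ t ∈ Icc 0 T, γ t = x + ∫ s in (0 : ℝ)..t, b (γ s))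
    {s t : ℝ} (hs : 0 ≤ s) (hst : s ≤ t) (ht : t ≤ T) :
    γ t - γ s = ∫ r in s..t, b (γ r) ∧ ‖γ t - γ s‖ ≤ B * (t - s) := by
  have hsub : ∀ r ∈ Icc 0 T, IntervalIntegrable (fun s => b (γ s)) volume 0 r := fun r hr =>
    hint.mono_set (by
      rw [uIcc_of_le hr.1, uIcc_of_le (hr.1.trans hr.2)]
      exact Icc_subset_Icc le_rfl hr.2)
  have hs' : s ∈ Icc 0 T := ⟨hs, hst.trans ht⟩
  have ht' : t ∈ Icc 0 T := ⟨hs.trans hst, ht⟩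
  have heq : γ t - γ s = ∫ r in s..t, b (γ r) := by
    rw [hγ t ht', hγ s hs', add_sub_add_left_eq_sub,
      intervalIntegral.integral_interval_sub_left (hsub t ht') (hsub s hs')]
  refine ⟨heq, ?_⟩
  rw [heq]
  refine (intervalIntegral.norm_integral_le_of_norm_le_const fun r _ => hB _).trans_eq ?_
  rw [abs_of_nonneg (sub_nonneg.2 hst)]

/-- Propagation of the squared error over one explicit Euler step. -/
lemma norm_sq_euler_step_le [CompleteSpace E] {b : E → E} {B T κ : ℝ} {γ : ℝ → E} {x y : E} {S : Set E}
    (hB : ∀ x, ‖b x‖ ≤ B) (hint : IntervalIntegrable (fun s => b (γ s)) volume 0 T)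
    (hγ : ∀ t ∈ Icc 0 T, γ t = x + ∫ s in (0 : ℝ)..t, b (γ s))
    (hκ : 0 ≤ κ)
    (hS : ∀ x ∈ S, ∀ y ∈ S, inner ℝ (b x - b y) (x - y) ≤ κ * ‖x - y‖ ^ 2)
    (hγS : ∀ t ∈ Icc 0 T, γ t ∈ S) (hyS : y ∈ S)
    {t h : ℝ} (ht : 0 ≤ t) (hh : 0 ≤ h) (hth : t + h ≤ T) :
    ‖γ (t + h) - (y + h • b y)‖ ^ 2 ≤
      (1 + 4 * κ * h) * ‖γ t - y‖ ^ 2 + h * (4 * κ * B ^ 2 * h ^ 2 + 8 * B ^ 2 * h) := by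
  have hB0 : 0 ≤ B := (norm_nonneg _).trans (hB y)
  have hle : t ≤ t + h := by linarith
  set e := γ t - y with he
  have hint' : IntervalIntegrable (fun s => b (γ s)) volume t (t + h) :=
    hint.mono_set (by
      rw [uIcc_of_le hle, uIcc_of_le (ht.trans (hle.trans hth))]
      exact Icc_subset_Icc ht hth)
  have hg : IntervalIntegrable (fun s => b (γ s) - b y) volume t (t + h) :=
    hint'.sub intervalIntegrable_const
  set I := ∫ s in t..t + h, (b (γ s) - b y) with hI
  have hdec : γ (t + h) - (y + h • b y) = e + I := by
    have h1 := (norm_integralCurve_sub_le hB hint hγ ht hle hth).1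
    rw [hI, intervalIntegral.integral_sub hint' intervalIntegrable_const,
      intervalIntegral.integral_const, ← h1, he, add_sub_cancel_left]
    abel
  have hgB : ∀ s, ‖b (γ s) - b y‖ ≤ 2 * B := fun s =>
    (norm_sub_le _ _).trans (by linarith [hB (γ s), hB y])
  have hInorm : ‖I‖ ≤ 2 * B * h := by
    refine (intervalIntegral.norm_integral_le_of_norm_le_const fun r _ => hgB r).trans_eq ?_
    rw [add_sub_cancel_left, abs_of_nonneg hh]
  have hinner : inner ℝ e I ≤ h * (κ * (‖e‖ + B * h) ^ 2 + B * h * (2 * B)) := by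
    have h1 : inner ℝ e I = ∫ s in t..t + h, inner ℝ e (b (γ s) - b y) :=
      ((innerSL ℝ e).intervalIntegral_comp_comm hg).symm
    have h2 : IntervalIntegrable (fun s => inner ℝ e (b (γ s) - b y)) volume t (t + h) :=
      ⟨(innerSL ℝ e).integrable_comp hg.1, (innerSL ℝ e).integrable_comp hg.2⟩
    rw [h1]
    refine (intervalIntegral.integral_mono_on hle h2 intervalIntegrable_const
      (g := fun _ => κ * (‖e‖ + B * h) ^ 2 + B * h * (2 * B)) fun s hs => ?_).trans_eq ?_
    · have hsT : s ≤ T := hs.2.trans hth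
      have hlip : ‖γ s - γ t‖ ≤ B * h :=
        (norm_integralCurve_sub_le hB hint hγ ht hs.1 hsT).2.trans
          (mul_le_mul_of_nonneg_left (by linarith [hs.2]) hB0)
      -- The one-sided condition pairs `b (γ s) - b y` with `γ s - y`, not with `e`; the replacement
      -- costs at most `Bh · 2B`.
      have hsplit : e = (γ s - y) - (γ s - γ t) := by rw [he]; abel
      have h3 : ‖γ s - y‖ ≤ ‖e‖ + B * h := by
        have : γ s - y = e + (γ s - γ t) := by rw [he]; abel
        rw [this]
        exact (norm_add_le _ _).trans (by linarith)
      have h4 : inner ℝ (γ s - y) (b (γ s) - b y) ≤ κ * (‖e‖ + B * h) ^ 2 := by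
        rw [real_inner_comm]
        refine (hS _ (hγS s ⟨ht.trans hs.1, hsT⟩) _ hyS).trans ?_
        gcongr
      have h5 : -inner ℝ (γ s - γ t) (b (γ s) - b y) ≤ B * h * (2 * B) :=
        (neg_le_abs _).trans ((abs_real_inner_le_norm _ _).trans
          (mul_le_mul hlip (hgB s) (norm_nonneg _) (by positivity)))
      calc inner ℝ e (b (γ s) - b y)
          = inner ℝ (γ s - y) (b (γ s) - b y) - inner ℝ (γ s - γ t) (b (γ s) - b y) := by
            rw [hsplit, inner_sub_left]
        _ ≤ _ := by linarith
    · rw [intervalIntegral.integral_const, add_sub_cancel_left, smul_eq_mul]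
  -- The term `8 B² h` is half from `‖I‖²`, half from the replacement cost in `hinner`; Young's
  -- inequality turns `2κ` into `4κ`.
  have hIsq : ‖I‖ ^ 2 ≤ (2 * B * h) ^ 2 := by gcongr
  have hyoung : (‖e‖ + B * h) ^ 2 ≤ 2 * ‖e‖ ^ 2 + 2 * (B * h) ^ 2 := add_sq_le.trans_eq (by ring)
  have hyoung' : h * (κ * (‖e‖ + B * h) ^ 2) ≤ h * (κ * (2 * ‖e‖ ^ 2 + 2 * (B * h) ^ 2)) := by
    gcongr
  rw [hdec, norm_add_sq_real]
  linarith

/-- Discrete Grönwall inequality: if `a (k + 1) ≤ (1 + l h) a k + h A` along the first `n` steps,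
then `a n` is bounded by the solution of the corresponding linear differential equation. -/
lemma le_exp_of_linear_recurrence {a : ℕ → ℝ} {l h A : ℝ} (hl : 0 < l) (hA : 0 ≤ A) (ha : ∀ k, 0 ≤ a k)
    (n : ℕ) (hstep : ∀ k < n, a (k + 1) ≤ (1 + l * h) * a k + h * A) :
    a n ≤ Real.exp (l * (n * h)) * a 0 + A * ((Real.exp (l * (n * h)) - 1) / l) := by
  induction n with
  | zero => simp
  | succ n ih =>
    have hexp : 1 + l * h ≤ Real.exp (l * h) := by linarith [Real.add_one_le_exp (l * h)]
    -- With this bound on the weight of `A`, the forcing terms telescope exactly.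
    have hh : h ≤ (Real.exp (l * h) - 1) / l := by rw [le_div_iff₀ hl]; linarith
    have hmul : Real.exp (l * ((n + 1 : ℕ) * h)) = Real.exp (l * h) * Real.exp (l * (n * h)) := by
      rw [← Real.exp_add]; push_cast; ring_nf
    calc a (n + 1) ≤ (1 + l * h) * a n + h * A := hstep n n.lt_succ_self
      _ ≤ Real.exp (l * h) *
            (Real.exp (l * (n * h)) * a 0 + A * ((Real.exp (l * (n * h)) - 1) / l)) +
          (Real.exp (l * h) - 1) / l * A := by
        gcongr
        · exact ha n
        · exact ih fun k hk => hstep k (hk.trans n.lt_succ_self)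
      _ = _ := by rw [hmul]; ring

end EulerErrorPointwise

/-- The Euler iterates of a field bounded by `B` move with speed at most `B`. -/
lemma norm_eulerIter_le {d : ℕ} {b : Rd d → Rd d} {B h ρ : ℝ} {X₀ : Rd d → Rd d} {x : Rd d}
    (hB : ∀ x, ‖b x‖ ≤ B) (hh : 0 ≤ h) (hx : ‖X₀ x‖ ≤ ρ) (n : ℕ) :
    ‖eulerIter b h X₀ n x‖ ≤ ρ + n * h * B := by
  induction n with
  | zero => simpa [eulerIter] using hx
  | succ n ih =>
    have h1 : ‖h • b (eulerIter b h X₀ n x)‖ ≤ h * B := by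
      rw [norm_smul, Real.norm_of_nonneg hh]
      gcongr
      exact hB _
    calc ‖eulerIter b h X₀ (n + 1) x‖
        ≤ ‖eulerIter b h X₀ n x‖ + ‖h • b (eulerIter b h X₀ n x)‖ := norm_add_le _ _
      _ ≤ (ρ + n * h * B) + h * B := add_le_add ih h1
      _ = ρ + (n + 1 : ℕ) * h * B := by push_cast; ring

lemma aemeasurable_eulerIter {d : ℕ} {b : Rd d → Rd d} (hb : Measurable b) (h : ℝ)
    {μ : Measure (Rd d)} {X₀ : Rd d → Rd d} (hX₀ : AEMeasurable X₀ μ) (n : ℕ) :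
    AEMeasurable (eulerIter b h X₀ n) μ := by
  induction n with
  | zero => exact hX₀
  | succ n ih => exact ih.add ((hb.comp_aemeasurable ih).const_smul h)

/-- Pointwise error estimate of order `1/2` for the explicit Euler scheme along an integral curve
of a bounded one-sided Lipschitz field. -/
lemma norm_euler_error_le {d : ℕ} {b : Rd d → Rd d} {B T κ ρ h : ℝ} {γ : ℝ → Rd d}
    {X₀ : Rd d → Rd d} {x : Rd d}
    (hB : ∀ x, ‖b x‖ ≤ B) (hint : IntervalIntegrable (fun s => b (γ s)) volume 0 T)
    (hγ : ∀ t ∈ Icc 0 T, γ t = x + ∫ s in (0 : ℝ)..t, b (γ s))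
    (hκ : 0 < κ) (hS : OneSidedLipschitzOn b (closedBall 0 (ρ + T * B)) κ)
    (hx : ‖x‖ ≤ ρ) (hX₀ : ‖X₀ x‖ ≤ ρ) (hh : 0 < h) {n : ℕ} (hn : n * h ≤ T) :
    ‖γ (n * h) - eulerIter b h X₀ n x‖ ≤
      Real.exp (2 * κ * T) * ‖γ 0 - X₀ x‖ +
        √(B ^ 2 * (2 * κ * T + 4) * (Real.exp (2 * κ * T) + 1)) *
          √((Real.exp (2 * κ * T) - 1) / (2 * κ)) * √h := by
  have hB0 : 0 ≤ B := (norm_nonneg _).trans (hB 0)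
  have hT : 0 ≤ T := le_trans (by positivity) hn
  have hone : 1 ≤ Real.exp (2 * κ * T) := Real.one_le_exp (by positivity)
  have hγ0 : γ 0 = x := by simpa using hγ 0 ⟨le_rfl, hT⟩
  have hγS : ∀ t ∈ Icc 0 T, γ t ∈ closedBall (0 : Rd d) (ρ + T * B) := fun t ht => by
    have h1 := (norm_integralCurve_sub_le hB hint hγ le_rfl ht.1 ht.2).2
    have h2 := norm_add_le (γ 0) (γ t - γ 0)
    rw [add_sub_cancel, hγ0] at h2
    rw [hγ0] at h1
    have h3 : B * (t - 0) ≤ T * B := by rw [sub_zero, mul_comm]; gcongr; exact ht.2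
    rw [mem_closedBall_zero_iff]
    linarith
  have hYS : ∀ k ≤ n, eulerIter b h X₀ k x ∈ closedBall (0 : Rd d) (ρ + T * B) := fun k hk => by
    rw [mem_closedBall_zero_iff]
    refine (norm_eulerIter_le hB hh.le hX₀ k).trans ?_
    have : (k : ℝ) * h ≤ T := le_trans (by gcongr) hn
    gcongr
  -- For `n = 0` the step `h` may exceed `T`, and `h ≤ T` is needed to bound `A` linearly in `h`.
  rcases Nat.eq_zero_or_pos n with rfl | hpos
  · have h0 : (1 : ℝ) * ‖γ 0 - X₀ x‖ ≤ Real.exp (2 * κ * T) * ‖γ 0 - X₀ x‖ := by gcongr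
    rw [one_mul] at h0
    simp only [Nat.cast_zero, zero_mul, eulerIter]
    exact h0.trans (le_add_of_nonneg_right (by positivity))
  have hhT : h ≤ T := by
    refine le_trans ?_ hn
    have : (1 : ℝ) ≤ n := by exact_mod_cast hpos
    nlinarith
  set A := 4 * κ * B ^ 2 * h ^ 2 + 8 * B ^ 2 * h with hAdef
  have hA : 0 ≤ A := by positivity
  have hgron := le_exp_of_linear_recurrence (a := fun k => ‖γ (k * h) - eulerIter b h X₀ k x‖ ^ 2)
    (l := 4 * κ) (h := h) (A := A) (by positivity) hA (fun _ => by positivity) n fun k hk => by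
      have hk1 : (k : ℝ) * h + h ≤ T := by
        refine le_trans ?_ hn
        have : (k : ℝ) + 1 ≤ n := by exact_mod_cast hk
        nlinarith
      have := norm_sq_euler_step_le hB hint hγ hκ.le hS hγS (hYS k hk.le) (by positivity) hh.le hk1
      simpa only [Nat.cast_succ, add_mul, one_mul, eulerIter] using this
  simp only [Nat.cast_zero, zero_mul, eulerIter] at hgron
  set e₀ := ‖γ 0 - X₀ x‖
  set M := Real.exp (2 * κ * T) with hM
  -- The squared error grows at rate `4κ`, the error itself at rate `2κ`.
  have hMsq : Real.exp (4 * κ * (n * h)) ≤ M ^ 2 := by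
    rw [hM, ← Real.exp_nat_mul]
    apply Real.exp_le_exp.2
    push_cast
    nlinarith
  have hAle : A ≤ 2 * (B ^ 2 * (2 * κ * T + 4) * h) := by
    have : κ * B ^ 2 * h * h ≤ κ * B ^ 2 * h * T := by gcongr
    rw [hAdef]; nlinarith
  -- Factoring `M² - 1 = (M - 1)(M + 1)` isolates `(M - 1) / (2κ)`; the factor `M + 1` goes into the
  -- constant.
  have hsum : ‖γ (n * h) - eulerIter b h X₀ n x‖ ^ 2 ≤
      (M * e₀) ^ 2 + B ^ 2 * (2 * κ * T + 4) * (M + 1) * ((M - 1) / (2 * κ)) * h := by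
    refine hgron.trans ?_
    calc _ ≤ M ^ 2 * e₀ ^ 2 + 2 * (B ^ 2 * (2 * κ * T + 4) * h) * ((M ^ 2 - 1) / (4 * κ)) := by
          have : 0 ≤ (Real.exp (4 * κ * (n * h)) - 1) / (4 * κ) :=
            div_nonneg (sub_nonneg.2 (Real.one_le_exp (by positivity))) (by positivity)
          gcongr
      _ = _ := by field_simp; ring
  have hM1 : 0 ≤ (M - 1) / (2 * κ) := div_nonneg (by linarith) (by positivity)
  -- A sum of two squares is at most the square of the sum, the cross term being nonnegative.
  refine abs_le_of_sq_le_sq' (hsum.trans ?_) (by positivity) |>.2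
  have hQ : (√(B ^ 2 * (2 * κ * T + 4) * (M + 1)) * √((M - 1) / (2 * κ)) * √h) ^ 2 =
      B ^ 2 * (2 * κ * T + 4) * (M + 1) * ((M - 1) / (2 * κ)) * h := by
    rw [mul_pow, mul_pow, Real.sq_sqrt (by positivity), Real.sq_sqrt hM1, Real.sq_sqrt hh.le]
  rw [← hQ, add_sq]
  have : 0 ≤ 2 * (M * e₀) *
      (√(B ^ 2 * (2 * κ * T + 4) * (M + 1)) * √((M - 1) / (2 * κ)) * √h) := by positivity
  linarith

/-- An affine pointwise bound on the norm passes to `L^p` norms. -/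
lemma eLpNorm_le_of_ae_norm_le_affine {α E F : Type*} [MeasurableSpace α] {μ : Measure α}
    [NormedAddCommGroup E] [NormedAddCommGroup F] {p : ℝ≥0∞} (hp : 1 ≤ p) {f : α → E} {g : α → F}
    (hg : AEStronglyMeasurable g μ) {a m : ℝ} (ha : 0 ≤ a) (hm : 0 ≤ m)
    (hfg : ∀ᵐ x ∂μ, ‖f x‖ ≤ a * ‖g x‖ + m) :
    eLpNorm f p μ ≤ ENNReal.ofReal a * eLpNorm g p μ +
      μ univ ^ p.toReal⁻¹ * ENNReal.ofReal m := by
  calc eLpNorm f p μ ≤ eLpNorm ((fun x => a * ‖g x‖) + fun _ => m) p μ :=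
        eLpNorm_mono_ae_real hfg
    _ ≤ eLpNorm (fun x => a * ‖g x‖) p μ + eLpNorm (fun _ => m) p μ :=
        eLpNorm_add_le (hg.norm.const_mul a) aestronglyMeasurable_const hp
    _ ≤ _ := by
        gcongr
        · refine (eLpNorm_const_smul a (fun x => ‖g x‖) p μ).le.trans_eq ?_
          rw [eLpNorm_norm, Real.enorm_eq_ofReal ha]
        · exact eLpNorm_le_of_ae_bound (.of_forall fun _ => (Real.norm_of_nonneg hm).le)

/-- Order `1/2` convergence in `L^p(B_R)` of the explicit Euler scheme to a regular Lagrangian flow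
of a bounded one-sided Lipschitz field. -/
lemma euler_error_memLp_and_eLpNorm_le {d : ℕ} {p : ℝ≥0∞} (hp : 1 ≤ p) {b : Rd d → Rd d}
    {B T κ R ρ h : ℝ} {X : ℝ → Rd d → Rd d} {L : ℝ≥0} (hb : Measurable b) (hB : ∀ x, ‖b x‖ ≤ B)
    (hX : IsRegularLagrangianFlow T b X L) (hRρ : R ≤ ρ) (hκ : 0 < κ)
    (hS : OneSidedLipschitzOn b (closedBall 0 (ρ + T * B)) κ) (hh : 0 < h) {n : ℕ}
    (hn : n * h ≤ T) {X₀ : Rd d → Rd d} (hmeas : AEMeasurable X₀ (volume.restrict (ball 0 R)))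
    (hX₀ : ∀ᵐ x ∂(volume.restrict (ball (0 : Rd d) R)), ‖X₀ x‖ ≤ ρ) :
    MemLp (fun x => X (n * h) x - eulerIter b h X₀ n x) p (volume.restrict (ball 0 R)) ∧
    eLpNorm (fun x => X (n * h) x - eulerIter b h X₀ n x) p (volume.restrict (ball 0 R)) ≤
      ENNReal.ofReal (Real.exp (2 * κ * T)) *
        eLpNorm (fun x => X 0 x - X₀ x) p (volume.restrict (ball 0 R)) +
      ENNReal.ofReal (volume.real (ball (0 : Rd d) R) ^ p.toReal⁻¹ *
        (√(B ^ 2 * (2 * κ * T + 4) * (Real.exp (2 * κ * T) + 1)) *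
          √((Real.exp (2 * κ * T) - 1) / (2 * κ)) * √h)) := by
  have hT : 0 ≤ T := le_trans (by positivity) hn
  have : IsFiniteMeasure ((volume : Measure (Rd d)).restrict (ball 0 R)) :=
    isFiniteMeasure_restrict.2 measure_ball_lt_top.ne
  have hXm : ∀ t ∈ Icc 0 T, AEMeasurable (X t) (volume.restrict (ball 0 R)) := fun t ht =>
    (hX.aemeasurable t ht).restrict
  have hm0 : AEStronglyMeasurable (fun x => X 0 x - X₀ x) (volume.restrict (ball 0 R)) :=
    ((hXm 0 ⟨le_rfl, hT⟩).sub hmeas).aestronglyMeasurable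
  have hmn : AEStronglyMeasurable (fun x => X (n * h) x - eulerIter b h X₀ n x)
      (volume.restrict (ball 0 R)) :=
    ((hXm _ ⟨by positivity, hn⟩).sub (aemeasurable_eulerIter hb h hmeas n)).aestronglyMeasurable
  have hpt : ∀ᵐ x ∂(volume.restrict (ball (0 : Rd d) R)),
      ‖X 0 x - X₀ x‖ ≤ ρ + ρ ∧ ‖X (n * h) x - eulerIter b h X₀ n x‖ ≤
        Real.exp (2 * κ * T) * ‖X 0 x - X₀ x‖ +
          √(B ^ 2 * (2 * κ * T + 4) * (Real.exp (2 * κ * T) + 1)) *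
            √((Real.exp (2 * κ * T) - 1) / (2 * κ)) * √h := by
    filter_upwards [ae_restrict_of_ae hX.integral_solution, hX₀, ae_restrict_mem measurableSet_ball]
      with x hsol hx₀ hxR
    have hxρ : ‖x‖ ≤ ρ := (mem_ball_zero_iff.1 hxR).le.trans hRρ
    refine ⟨?_, norm_euler_error_le (γ := fun t => X t x) hB hsol.1 hsol.2 hκ hS hxρ hx₀ hh hn⟩
    have h0 : X 0 x = x := by simpa using hsol.2 0 ⟨le_rfl, hT⟩
    rw [h0]
    exact (norm_sub_le _ _).trans (add_le_add hxρ hx₀)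
  refine ⟨MemLp.of_bound hmn _ (hpt.mono fun x hx => hx.2.trans
    (add_le_add_left (mul_le_mul_of_nonneg_left hx.1 (Real.exp_pos _).le) _)), ?_⟩
  refine (eLpNorm_le_of_ae_norm_le_affine hp hm0 (Real.exp_pos _).le (by positivity)
    (hpt.mono fun x hx => hx.2)).trans_eq ?_
  rw [Measure.restrict_apply_univ, ENNReal.ofReal_mul (p := volume.real (ball (0 : Rd d) R) ^ p.toReal⁻¹) (by positivity),
    ← ENNReal.ofReal_rpow_of_nonneg measureReal_nonneg (by positivity),
    ofReal_measureReal measure_ball_lt_top.ne]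

/-- The constant `c` depends only on `d` and `p`, and `C` only on `d, p, R, ρ, T, B, κ, K`, where
`B` bounds `|b|`, `L` is the compressibility constant of the flow, `D` bounds `‖Db‖_{L^p}`,
`K = c L^{1/p} D B`, and `κ` is any positive one-sided Lipschitz constant of `b` on the ball of
radius `ρ + T B`, which contains all the trajectories and iterates; that there is one is the first
part of the conclusion. In `(1 / p).toReal` the case `p = ∞` gives the exponent `0`. -/
theorem theorem3p1 (d : ℕ) (p : ℝ≥0∞) (hp : 1 < p) :
    ∃ (c : ℝ) (C : ℝ → ℝ → ℝ → ℝ → ℝ → ℝ → ℝ),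
      0 < c ∧ (∀ R ρ T B κ K : ℝ, 0 ≤ C R ρ T B κ K) ∧
      ∀ (b : Rd d → Rd d) (Db : Rd d → Rd d →L[ℝ] Rd d) (B : ℝ) (D : ℝ≥0),
        Measurable b → (∀ x, ‖b x‖ ≤ B) → MemW1p p b Db → eLpNorm Db p volume ≤ (D : ℝ≥0∞) →
        (∀ S : Set (Rd d), IsCompact S → ∃ ν : ℝ, OneSidedLipschitzOn b S ν) →
        MemLp (divNegPart Db) ∞ volume →
      ∀ (T : ℝ) (X : ℝ → Rd d → Rd d) (L : ℝ≥0),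
        0 < T → IsRegularLagrangianFlow T b X L →
      ∀ R ρ : ℝ, 0 < R → R ≤ ρ →
        (∃ κ : ℝ, 0 < κ ∧ OneSidedLipschitzOn b (closedBall 0 (ρ + T * B)) κ) ∧
        ∀ κ K : ℝ, 0 < κ → OneSidedLipschitzOn b (closedBall 0 (ρ + T * B)) κ →
          K = c * (L : ℝ) ^ (1 / p).toReal * (D : ℝ) * B →
        ∀ (h : ℝ) (n : ℕ), 0 < h → (n : ℝ) * h ≤ T →
          (∀ X₀ : Rd d → Rd d, AEMeasurable X₀ (volume.restrict (ball 0 R)) →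
            (∀ᵐ x ∂(volume.restrict (ball (0 : Rd d) R)), ‖X₀ x‖ ≤ ρ) →
            MemLp (fun x => X (n * h) x - eulerIter b h X₀ n x) p (volume.restrict (ball 0 R)) ∧
            eLpNorm (fun x => X (n * h) x - eulerIter b h X₀ n x) p (volume.restrict (ball 0 R)) ≤
              ENNReal.ofReal
                (C R ρ T B κ K * √((expConst T κ K - 1) / (2 * κ)) * h ^ (1 / 2 : ℝ)) +
              ENNReal.ofReal (expConst T κ K) *
                eLpNorm (fun x => X 0 x - X₀ x) p (volume.restrict (ball 0 R))) ∧
          eLpNorm (fun x => X (n * h) x - eulerIter b h (fun y => y) n x) p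
              (volume.restrict (ball 0 R)) ≤
            ENNReal.ofReal
              (C R ρ T B κ K * √((expConst T κ K - 1) / (2 * κ)) * h ^ (1 / 2 : ℝ)) := by
  -- Any `c > 0` would do, since only `K ≥ 0` matters. For `p = ∞` the exponent is `0⁻¹ = 0`, so the
  -- volume factor is `1`.
  refine ⟨1, fun R _ T B κ _ => volume.real (ball (0 : Rd d) R) ^ p.toReal⁻¹ *
    √(B ^ 2 * (2 * κ * T + 4) * (Real.exp (2 * κ * T) + 1)), one_pos,
    fun _ _ _ _ _ _ => by positivity, ?_⟩
  intro b Db B D hb hB _ _ hosl _ T X L hT hX R ρ hR hRρ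
  refine ⟨?_, ?_⟩
  · obtain ⟨ν, hν⟩ := hosl _ (isCompact_closedBall (0 : Rd d) (ρ + T * B))
    refine ⟨max ν 1, by positivity, fun x hx y hy => (hν x hx y hy).trans ?_⟩
    gcongr
    exact le_max_left _ _
  intro κ K hκ hS hK h n hh hn
  have hB0 : 0 ≤ B := (norm_nonneg _).trans (hB 0)
  have hK0 : 0 ≤ K := by rw [hK]; positivity
  have hexp : Real.exp (2 * κ * T) ≤ expConst T κ K := by
    refine Real.exp_le_exp.2 ?_
    have : 0 ≤ T * (K * T) := by positivity
    linarith
  have hmain : ∀ X₀ : Rd d → Rd d, AEMeasurable X₀ (volume.restrict (ball 0 R)) →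
      (∀ᵐ x ∂(volume.restrict (ball (0 : Rd d) R)), ‖X₀ x‖ ≤ ρ) →
      MemLp (fun x => X (n * h) x - eulerIter b h X₀ n x) p (volume.restrict (ball 0 R)) ∧
      eLpNorm (fun x => X (n * h) x - eulerIter b h X₀ n x) p (volume.restrict (ball 0 R)) ≤
        ENNReal.ofReal (volume.real (ball (0 : Rd d) R) ^ p.toReal⁻¹ *
          √(B ^ 2 * (2 * κ * T + 4) * (Real.exp (2 * κ * T) + 1)) *
          √((expConst T κ K - 1) / (2 * κ)) * h ^ (1 / 2 : ℝ)) +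
        ENNReal.ofReal (expConst T κ K) *
          eLpNorm (fun x => X 0 x - X₀ x) p (volume.restrict (ball 0 R)) := by
    intro X₀ hmeas hX₀
    obtain ⟨hmem, hle⟩ :=
      euler_error_memLp_and_eLpNorm_le hp.le hb hB hX hRρ hκ hS hh hn hmeas hX₀
    refine ⟨hmem, hle.trans ?_⟩
    rw [add_comm, ← Real.sqrt_eq_rpow, ← mul_assoc, ← mul_assoc]
    gcongr
  refine ⟨hmain, ?_⟩
  -- The flow starts at the identity almost everywhere, so the initial error vanishes.
  have hid := (hmain (fun y => y) aemeasurable_id ?_).2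
  · have h0 : (fun x => X 0 x - x) =ᵐ[volume.restrict (ball 0 R)] 0 := by
      filter_upwards [ae_restrict_of_ae hX.integral_solution] with x hsol
      have := hsol.2 0 ⟨le_rfl, hT.le⟩
      simp [this]
    rwa [eLpNorm_congr_ae h0, eLpNorm_zero, mul_zero, add_zero] at hid
  · filter_upwards [ae_restrict_mem measurableSet_ball] with x hx
    exact (mem_ball_zero_iff.1 hx).le.trans hRρ
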